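/- Let $\Delta=\{z\in\mathbb C:|z|<1\}$ be the open unit disc. A weight on an open set $U\subseteq\mathbb C$ is a continuous, bounded, strictly positive function $v\colon U\to\mathbb R$. Let $\mathcal H_v(U)$ be the space of all holomorphic $f\colon U\to\mathbb C$ with $\|f\|_v:=\sup_{z\in U}v(z)|f(z)|<\infty$, with norm $\|\cdot\|_v$, and let $\mathcal H_{v_o}(U)$ be the subspace of those $f$ for which $v(z)|f(z)|$ converges to $0$ as $z$ converges to the boundary of $U$; here a function $g$ on $U$ converges to $0$ on the boundary of $U$ if for every $\epsilon>0$ there is a compact $K\subset U$ with $|g(z)|<\epsilon$ for all $z\in U\setminus K$. For $z\in U$ let $\delta_z(f)=f(z)$. The weight $v$ is complete if, for every $z\in U$, the functional $v(z)\delta_z$ is an extreme point of the closed unit ball of the dual space $\mathcal H_{v_o}(U)'$. **Theorem.** Let $V$ be a connected open subset of $\mathbb C$, and let $v\colon\Delta\to\mathbb R$ and $w\colon V\to\mathbb R$ be weights, where $v$ is complete and converges to $0$ on the boundary of $\Delta$. Let $T\colon\mathcal H_{v_o}(\Delta)\to\mathcal H_{w_o}(V)$ be a linear isometry (not necessarily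 surjective). Then there are a surjective analytic function $\phi\colon V\to\Delta$ and a function $h_\phi\in\mathcal H_{w_o}(V)$ such that $$T(f)(z)=h_\phi(z)\,f(\phi(z))$$ for all $f\in\mathcal H_{v_o}(\Delta)$ and all $z\in V$. -/

import Mathlib

open TopologicalSpace

noncomputable section

namespace WeightedHolo

/-- The open unit disc of the complex plane. -/
def disc : Opens ℂ := ⟨Metric.ball (0 : ℂ) 1, Metric.isOpen_ball⟩

/-- A weight on an open set `U`: a continuous, bounded, strictly positive function on `U`. -/
structure Weight (U : Opens ℂ) where
  toFun : U → ℝ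
  continuous' : Continuous toFun
  pos' : ∀ z, 0 < toFun z
  bdd' : BddAbove (Set.range toFun)

instance {U : Opens ℂ} : CoeFun (Weight U) (fun _ => U → ℝ) := ⟨Weight.toFun⟩

variable {U : Opens ℂ}

/-- A function on the open set `U` is holomorphic if it is the restriction to `U` of a function
that is complex differentiable at every point of `U`. -/
def IsHolomorphic (f : U → ℂ) : Prop :=
  ∃ F : ℂ → ℂ, DifferentiableOn ℂ F (U : Set ℂ) ∧ ∀ z : U, F z = f z

/-- `g(z)` converges to `0` as `z` converges to the boundary of `U`: for every `ε > 0` there is a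
compact subset `K` of `U` with `|g| < ε` on `U \ K`. -/
def VanishesAtBoundary (g : U → ℝ) : Prop :=
  ∀ ε : ℝ, 0 < ε → ∃ K : Set ℂ, IsCompact K ∧ K ⊆ (U : Set ℂ) ∧
    ∀ z : U, (z : ℂ) ∉ K → |g z| < ε

theorem Weight.mul_norm_add_le (v : Weight U) (f g : U → ℂ) (z : U) :
    v z * ‖(f + g) z‖ ≤ v z * ‖f z‖ + v z * ‖g z‖ := by
  rw [← mul_add]
  exact mul_le_mul_of_nonneg_left (norm_add_le _ _) (v.pos' z).le

/-- The holomorphic functions `f` on `U` with `sup_{z ∈ U} v(z)|f(z)| < ∞`, as a vector space of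
functions on `U`. -/
def hvSubmodule (v : Weight U) : Submodule ℂ (U → ℂ) where
  carrier := {f | IsHolomorphic f ∧ BddAbove (Set.range fun z : U => v z * ‖f z‖)}
  zero_mem' := by
    refine ⟨⟨fun _ => 0, differentiableOn_const 0, fun _ => rfl⟩, 0, ?_⟩
    rintro _ ⟨z, rfl⟩
    simp
  add_mem' := by
    rintro f g ⟨⟨F, hF, hFf⟩, a, ha⟩ ⟨⟨G, hG, hGg⟩, b, hb⟩
    refine ⟨⟨F + G, hF.add hG, fun z => by simp [hFf, hGg]⟩, a + b, ?_⟩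
    rintro _ ⟨z, rfl⟩
    exact (v.mul_norm_add_le f g z).trans (add_le_add (ha ⟨z, rfl⟩) (hb ⟨z, rfl⟩))
  smul_mem' := by
    rintro c f ⟨⟨F, hF, hFf⟩, a, ha⟩
    refine ⟨⟨c • F, hF.const_smul c, fun z => by simp [hFf]⟩, ‖c‖ * a, ?_⟩
    rintro _ ⟨z, rfl⟩
    have h := mul_le_mul_of_nonneg_left (ha ⟨z, rfl⟩) (norm_nonneg c)
    simp only [Pi.smul_apply, norm_smul] at h ⊢
    linarith

/-- The space `H_v(U)`. This is a type of its own so that its topology is the one given by the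
weighted sup-norm and not the topology of pointwise convergence. -/
def Hv (v : Weight U) : Type := hvSubmodule v

variable {v : Weight U}

instance : AddCommGroup (Hv v) := inferInstanceAs (AddCommGroup (hvSubmodule v))

instance : Module ℂ (Hv v) := inferInstanceAs (Module ℂ (hvSubmodule v))

/-- The function on `U` that an element of `H_v(U)` is. -/
instance : CoeFun (Hv v) (fun _ => U → ℂ) := ⟨fun f => f.1⟩

theorem Hv.ext {f g : Hv v} (h : ∀ z, f z = g z) : f = g := Subtype.ext (funext h)

theorem Hv.zero_apply (z : U) : (0 : Hv v) z = 0 := rfl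

theorem Hv.add_apply (f g : Hv v) (z : U) : (f + g) z = f z + g z := rfl

theorem Hv.neg_apply (f : Hv v) (z : U) : (-f) z = -f z := rfl

theorem Hv.smul_apply (c : ℂ) (f : Hv v) (z : U) : (c • f) z = c * f z := rfl

theorem Hv.isHolomorphic (f : Hv v) : IsHolomorphic (f : U → ℂ) := f.2.1

theorem Hv.bddAbove (f : Hv v) : BddAbove (Set.range fun z : U => v z * ‖f z‖) := f.2.2

/-- The norm `‖f‖_v = sup_{z ∈ U} v(z)|f(z)|`. -/
instance : Norm (Hv v) := ⟨fun f => ⨆ z : U, v z * ‖f z‖⟩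

theorem Hv.norm_def (f : Hv v) : ‖f‖ = ⨆ z : U, v z * ‖f z‖ := rfl

theorem Hv.le_norm (f : Hv v) (z : U) : v z * ‖f z‖ ≤ ‖f‖ := le_ciSup f.bddAbove z

theorem Hv.norm_nonneg' (f : Hv v) : 0 ≤ ‖f‖ :=
  Real.iSup_nonneg fun z => mul_nonneg (v.pos' z).le (norm_nonneg _)

theorem Hv.norm_le {f : Hv v} {C : ℝ} (hC : 0 ≤ C) (h : ∀ z, v z * ‖f z‖ ≤ C) : ‖f‖ ≤ C :=
  Real.iSup_le h hC

instance : NormedAddCommGroup (Hv v) :=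
  AddGroupNorm.toNormedAddCommGroup
    { toFun := fun f => ‖f‖
      map_zero' := le_antisymm
        (Hv.norm_le le_rfl fun z => by simp [Hv.zero_apply]) (Hv.norm_nonneg' _)
      add_le' := fun f g => Hv.norm_le (add_nonneg f.norm_nonneg' g.norm_nonneg') fun z =>
        (v.mul_norm_add_le f g z).trans (add_le_add (f.le_norm z) (g.le_norm z))
      neg' := fun f => by simp only [Hv.norm_def, Hv.neg_apply, norm_neg]
      eq_zero_of_map_eq_zero' := fun f hf => Hv.ext fun z => by
        have h1 : v z * ‖f z‖ ≤ 0 := (f.le_norm z).trans (le_of_eq hf)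
        have h2 : ‖f z‖ ≤ 0 := nonpos_of_mul_nonpos_right h1 (v.pos' z)
        exact norm_le_zero_iff.1 h2 }

instance : NormedSpace ℂ (Hv v) where
  norm_smul_le c f := Hv.norm_le (mul_nonneg (norm_nonneg c) f.norm_nonneg') fun z => by
    have h := mul_le_mul_of_nonneg_left (f.le_norm z) (norm_nonneg c)
    rw [Hv.smul_apply, norm_mul]
    linarith

/-- The subspace `H_{v_o}(U)` of those `f` in `H_v(U)` for which `v(z)|f(z)|` converges to `0` as
`z` converges to the boundary of `U`; its norm is the restriction of `‖·‖_v`. -/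
def Hvo (v : Weight U) : Submodule ℂ (Hv v) where
  carrier := {f | VanishesAtBoundary fun z : U => v z * ‖f z‖}
  zero_mem' := fun ε hε => ⟨∅, isCompact_empty, Set.empty_subset _, fun z _ => by
    simpa [Hv.zero_apply] using hε⟩
  add_mem' := by
    intro f g hf hg ε hε
    obtain ⟨K, hK, hKU, hKf⟩ := hf (ε / 2) (half_pos hε)
    obtain ⟨L, hL, hLU, hLg⟩ := hg (ε / 2) (half_pos hε)
    refine ⟨K ∪ L, hK.union hL, Set.union_subset hKU hLU, fun z hz => ?_⟩
    have h1 := (abs_lt.1 (hKf z fun h => hz (Or.inl h))).2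
    have h2 := (abs_lt.1 (hLg z fun h => hz (Or.inr h))).2
    have h3 : v z * ‖(f + g) z‖ ≤ v z * ‖f z‖ + v z * ‖g z‖ := v.mul_norm_add_le f g z
    rw [abs_of_nonneg (mul_nonneg (v.pos' z).le (norm_nonneg _))]
    linarith
  smul_mem' := by
    intro c f hf ε hε
    have hc : 0 < ‖c‖ + 1 := by positivity
    obtain ⟨K, hK, hKU, hKf⟩ := hf (ε / (‖c‖ + 1)) (div_pos hε hc)
    refine ⟨K, hK, hKU, fun z hz => ?_⟩
    have h1 := (lt_div_iff₀ hc).1 (abs_lt.1 (hKf z hz)).2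
    have h0 : 0 ≤ v z * ‖f z‖ := mul_nonneg (v.pos' z).le (norm_nonneg _)
    rw [abs_of_nonneg (mul_nonneg (v.pos' z).le (norm_nonneg _)), Hv.smul_apply, norm_mul]
    nlinarith

/-- The evaluation functional `δ_z : f ↦ f(z)` in the dual of `H_{v_o}(U)`. -/
def evalAt (v : Weight U) (z : U) : StrongDual ℂ (Hvo v) :=
  LinearMap.mkContinuous
    { toFun := fun f => (f : Hv v) z
      map_add' := fun _ _ => rfl
      map_smul' := fun _ _ => rfl } (v z)⁻¹ fun f => by
    have h := (f : Hv v).le_norm z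
    rw [inv_mul_eq_div, le_div_iff₀ (v.pos' z), mul_comm]
    exact h

/-- The `v`-boundary of `U`: the set of all `z ∈ U` such that `v(z)δ_z` is an extreme point of the
closed unit ball of the dual of `H_{v_o}(U)`. -/
def vBoundary (v : Weight U) : Set U :=
  {z | ((v z : ℝ) : ℂ) • evalAt v z ∈
    Set.extremePoints ℝ (Metric.closedBall (0 : StrongDual ℂ (Hvo v)) 1)}

/-- A weight on `U` is complete if its `v`-boundary is all of `U`. -/
def Weight.IsComplete (v : Weight U) : Prop := vBoundary v = Set.univ

end WeightedHolo

end

/-!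
Since `T` is an isometry, the functionals `f ↦ c * w ζ * T f ζ` with `ζ ∈ V` and `|c| = 1` form,
together with `0`, a weak-* compact norming subset of the dual of `H_{v_o}(Δ)`. By Milman's theorem
it contains every extreme point `v a • δ_a` of the dual ball, so `T f ζ = T 1 ζ * f a` for
uncountably many `ζ`, each with a suitable `a ∈ Δ`.

The identity theorem then gives `(T z)^(n+1) = (T 1)^n * T (z^(n+1))`, where `z` is the coordinate
function. At each point `T (z^(n+1))` is bounded in `n`, so `|T z| ≤ |T 1|` and `φ = T z / T 1`
extends holomorphically to `V`, with values in `Δ` by the maximum principle. A second use of the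
identity theorem yields `T f = T 1 * (f ∘ φ)`.
-/

section Convexity

open Set Topology

variable {E : Type*} [AddCommGroup E] [Module ℝ E] [TopologicalSpace E]

theorem isCompact_convexJoin [ContinuousAdd E] [ContinuousSMul ℝ E] {s t : Set E}
    (hs : IsCompact s) (ht : IsCompact t) : IsCompact (convexJoin ℝ s t) := by
  have himage : convexJoin ℝ s t = (fun p : (E × E) × ℝ => (1 - p.2) • p.1.1 + p.2 • p.1.2) ''
      ((s ×ˢ t) ×ˢ Icc (0 : ℝ) 1) := by
    ext x
    simp only [mem_convexJoin, segment_eq_image, mem_image, mem_prod, Prod.exists]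
    grind
  rw [himage]
  exact ((hs.prod ht).prod isCompact_Icc).image (by fun_prop)

theorem isCompact_convexHull_biUnion [ContinuousAdd E] [ContinuousSMul ℝ E] {ι : Type*}
    (t : Finset ι) {A : ι → Set E} (hA : ∀ i ∈ t, IsCompact (A i))
    (hconv : ∀ i ∈ t, Convex ℝ (A i)) : IsCompact (convexHull ℝ (⋃ i ∈ t, A i)) := by
  classical
  induction t using Finset.induction_on with
  | empty => simp
  | insert i t _ ih =>
    rw [Finset.forall_mem_insert] at hA hconv
    have ht := ih hA.2 hconv.2
    rw [Finset.set_biUnion_insert]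
    rcases (A i).eq_empty_or_nonempty with hi | hi
    · simpa only [hi, empty_union] using ht
    rcases (⋃ j ∈ t, A j).eq_empty_or_nonempty with hU | hU
    · simpa only [hU, union_empty, hconv.1.convexHull_eq] using hA.1
    · rw [convexHull_union hi hU, hconv.1.convexHull_eq]
      exact isCompact_convexJoin hA.1 ht

variable [IsTopologicalAddGroup E] [ContinuousSMul ℝ E] [LocallyConvexSpace ℝ E] [T2Space E]

theorem exists_isCompact_convex_mem_nhdsWithin_notMem {C : Set E} (hC : IsCompact C)
    (hconv : Convex ℝ C) {x y : E} (hyx : y ≠ x) :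
    ∃ A ∈ 𝓝[C] y, A ⊆ C ∧ IsCompact A ∧ Convex ℝ A ∧ x ∉ A := by
  obtain ⟨f, hf⟩ := geometric_hahn_banach_point_point hyx
  obtain ⟨c, hyc, hcx⟩ := exists_between hf
  have hy : {z | f z ≤ c} ∈ 𝓝 y := f.continuous.continuousAt.eventually_le_const hyc
  exact ⟨C ∩ {z | f z ≤ c}, inter_mem_nhdsWithin C hy, inter_subset_left,
    hC.inter_right (isClosed_le f.continuous continuous_const),
    hconv.inter (convex_halfSpace_le f.toLinearMap.isLinear c), fun h => hcx.not_ge h.2⟩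

/-- Milman's converse to the Krein–Milman theorem. -/
theorem extremePoints_closedConvexHull_subset {K : Set E} (hK : IsCompact K)
    (hC : IsCompact (closedConvexHull ℝ K)) : (closedConvexHull ℝ K).extremePoints ℝ ⊆ K := by
  intro x hx
  by_contra hxK
  choose! A hA_nhds hA_subset hA_compact hA_convex hxA using fun y (hy : y ∈ K) =>
    exists_isCompact_convex_mem_nhdsWithin_notMem hC convex_closedConvexHull
      (ne_of_mem_of_not_mem hy hxK)
  obtain ⟨t, htK, hKt⟩ := hK.elim_nhdsWithin_subcover A fun y hy =>
    nhdsWithin_mono y subset_closedConvexHull (hA_nhds y hy)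
  have hcompact : IsCompact (convexHull ℝ (⋃ y ∈ t, A y)) :=
    isCompact_convexHull_biUnion t (fun y hy => hA_compact y (htK y hy))
      fun y hy => hA_convex y (htK y hy)
  -- Finitely many compact convex pieces need no closure, so `x` lies in one of them.
  have hhull : convexHull ℝ (⋃ y ∈ t, A y) = closedConvexHull ℝ K :=
    (convexHull_min (iUnion₂_subset fun y hy => hA_subset y (htK y hy))
      convex_closedConvexHull).antisymm
      (closedConvexHull_min (hKt.trans (subset_convexHull ℝ _)) (convex_convexHull ℝ _)
        hcompact.isClosed)
  rw [← hhull] at hx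
  obtain ⟨y, hy, hxy⟩ := mem_iUnion₂.1 (extremePoints_convexHull_subset hx)
  exact hxA y (htK y hy) hxy

end Convexity

section NormingSets

open Set Metric

variable {𝕜 X : Type*} [RCLike 𝕜] [SeminormedAddCommGroup X] [NormedSpace 𝕜 X]

instance weakDual_locallyConvexSpace : LocallyConvexSpace ℝ (WeakDual 𝕜 X) :=
  inferInstanceAs (LocallyConvexSpace ℝ (WeakBilin (topDualPairing 𝕜 X)))

theorem norm_le_one_iff_forall_re_le (L : StrongDual 𝕜 X) :
    ‖L‖ ≤ 1 ↔ ∀ x, RCLike.re (L x) ≤ ‖x‖ := by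
  constructor
  · intro hL x
    simpa only [one_mul] using (RCLike.re_le_norm _).trans (L.le_of_opNorm_le hL x)
  · intro hL
    refine L.opNorm_le_bound zero_le_one fun x => ?_
    obtain ⟨c, hc, hcx⟩ := RCLike.exists_norm_eq_mul_self (L x)
    have h := hL (c • x)
    rwa [map_smul, smul_eq_mul, ← hcx, RCLike.ofReal_re, norm_smul, hc] at h

theorem closedConvexHull_eq_preimage_closedBall {K : Set (WeakDual 𝕜 X)}
    (hK : ∀ x, IsLUB ((fun k => RCLike.re (k x)) '' K) ‖x‖) :
    closedConvexHull ℝ K =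
      WeakDual.toStrongDual ⁻¹' closedBall (0 : StrongDual 𝕜 X) 1 := by
  have hmem (k : WeakDual 𝕜 X) : k ∈ WeakDual.toStrongDual ⁻¹' closedBall (0 : StrongDual 𝕜 X) 1 ↔
      ∀ x, RCLike.re (k x) ≤ ‖x‖ := by
    rw [mem_preimage, mem_closedBall_zero_iff]
    exact norm_le_one_iff_forall_re_le _
  have : IsScalarTower ℝ 𝕜 (WeakDual 𝕜 X) := inferInstanceAs (IsScalarTower ℝ 𝕜 (X →L[𝕜] 𝕜))
  apply Subset.antisymm
  · refine closedConvexHull_min (fun k hk => (hmem k).2 fun x => (hK x).1 ⟨k, hk, rfl⟩) ?_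
      (WeakDual.isClosed_closedBall 0 1)
    exact (convex_closedBall (0 : StrongDual 𝕜 X) 1)
  · intro k hk
    by_contra hkK
    obtain ⟨F, u, hFu, huF⟩ := RCLike.geometric_hahn_banach_closed_point (𝕜 := 𝕜)
      (convex_closedConvexHull (s := K)) isClosed_closedConvexHull hkK
    obtain ⟨x, rfl⟩ := LinearMap.dualEmbedding_surjective (topDualPairing 𝕜 X) F
    have hxu : ‖x‖ ≤ u :=
      (hK x).2 (forall_mem_image.2 fun l hl => (hFu l (subset_closedConvexHull hl)).le)
    exact (huF.trans_le ((hmem k).1 hk x)).not_ge hxu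

theorem toWeakDual_mem_of_mem_extremePoints {K : Set (WeakDual 𝕜 X)} (hK : IsCompact K)
    (hnorming : ∀ x, IsLUB ((fun k => RCLike.re (k x)) '' K) ‖x‖) {L : StrongDual 𝕜 X}
    (hL : L ∈ (closedBall (0 : StrongDual 𝕜 X) 1).extremePoints ℝ) :
    StrongDual.toWeakDual L ∈ K := by
  have hhull := closedConvexHull_eq_preimage_closedBall hnorming
  refine extremePoints_closedConvexHull_subset hK ?_ ?_
  · rw [hhull]
    exact WeakDual.isCompact_closedBall 0 1
  · rw [hhull]
    exact hL

theorem isLUB_image_re_mul {P : Type*} {e : P → 𝕜} {M : ℝ}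
    (h : IsLUB (range fun p => ‖e p‖) M) :
    IsLUB ((fun q : 𝕜 × P => RCLike.re (q.1 * e q.2)) '' (sphere 0 1 ×ˢ univ)) M := by
  refine ⟨?_, fun u hu => h.2 ?_⟩
  · rintro _ ⟨⟨c, p⟩, ⟨hc, -⟩, rfl⟩
    calc RCLike.re (c * e p) ≤ ‖c * e p‖ := RCLike.re_le_norm _
      _ = ‖e p‖ := by rw [norm_mul, mem_sphere_zero_iff_norm.1 hc, one_mul]
      _ ≤ M := h.1 ⟨p, rfl⟩
  · rintro _ ⟨p, rfl⟩
    obtain ⟨c, hc, hcp⟩ := RCLike.exists_norm_eq_mul_self (e p)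
    refine hu ⟨(c, p), ⟨mem_sphere_zero_iff_norm.2 hc, trivial⟩, ?_⟩
    simp only [← hcp, RCLike.ofReal_re]

theorem exists_smul_eq_toWeakDual_of_mem_extremePoints {P : Type*} [TopologicalSpace P]
    [CompactSpace P] {e : P → WeakDual 𝕜 X} (he : Continuous e)
    (hnorming : ∀ x, IsLUB (range fun p => ‖e p x‖) ‖x‖) {L : StrongDual 𝕜 X}
    (hL : L ∈ (closedBall (0 : StrongDual 𝕜 X) 1).extremePoints ℝ) :
    ∃ c : 𝕜, ‖c‖ = 1 ∧ ∃ p, c • e p = StrongDual.toWeakDual L := by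
  have hK : IsCompact ((fun q : 𝕜 × P => q.1 • e q.2) '' (sphere 0 1 ×ˢ univ)) :=
    ((isCompact_sphere 0 1).prod isCompact_univ).image <|
      WeakDual.continuous_of_continuous_eval fun x =>
        continuous_fst.mul (((WeakDual.eval_continuous x).comp he).comp continuous_snd)
  obtain ⟨⟨c, p⟩, ⟨hc, -⟩, hcp⟩ := toWeakDual_mem_of_mem_extremePoints hK
    (fun x => by rw [image_image]; exact isLUB_image_re_mul (hnorming x)) hL
  exact ⟨c, mem_sphere_zero_iff_norm.1 hc, p, hcp⟩

end NormingSets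

section ComplexAnalysis

open Set Filter Topology

theorem eqOn_of_not_countable_setOf_eq {𝕜 E : Type*} [NontriviallyNormedField 𝕜]
    [SecondCountableTopology 𝕜] [NormedAddCommGroup E] [NormedSpace 𝕜 E] {U : Set 𝕜}
    {f g : 𝕜 → E} (hf : AnalyticOnNhd 𝕜 f U) (hg : AnalyticOnNhd 𝕜 g U) (hU : IsPreconnected U)
    (hfg : ¬ ({z | f z = g z} ∩ U).Countable) : EqOn f g U := by
  refine (hf.eqOn_or_eventually_ne_of_preconnected hg hU).resolve_right fun hne => hfg ?_
  have : DiscreteTopology ({z | f z = g z} ∩ U : Set 𝕜) :=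
    (isDiscrete_of_codiscreteWithin hne).to_subtype
  exact countable_coe_iff.1 countable_of_Lindelof_of_discrete

variable {E : Type*} [NormedAddCommGroup E] [NormedSpace ℂ E]

theorem norm_lt_of_forall_norm_le_of_norm_lt {F : Type*} [NormedAddCommGroup F]
    [NormedSpace ℂ F] {U : Set F} (hU : IsOpen U) (hUc : IsPreconnected U) {f : F → E}
    (hf : DifferentiableOn ℂ f U) {M : ℝ} (hle : ∀ z ∈ U, ‖f z‖ ≤ M) {a : F} (ha : a ∈ U)
    (hlt : ‖f a‖ < M) {z : F} (hz : z ∈ U) : ‖f z‖ < M := by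
  refine (hle z hz).lt_of_ne fun hzM => hlt.ne ?_
  have hmax : IsMaxOn (norm ∘ f) U z := fun x hx => (hle x hx).trans hzM.ge
  exact (Complex.norm_eqOn_of_isPreconnected_of_isMaxOn hUc hU hf hz hmax ha).trans hzM

theorem differentiableAt_limUnder_nhdsNE [CompleteSpace E] {f : ℂ → E} {c : ℂ}
    (hd : ∀ᶠ z in 𝓝[≠] c, DifferentiableAt ℂ f z)
    (hb : IsBoundedUnder (· ≤ ·) (𝓝[≠] c) (‖f ·‖)) :
    DifferentiableAt ℂ (fun z => limUnder (𝓝[≠] z) f) c := by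
  have hs : {z | z ≠ c → DifferentiableAt ℂ f z} ∈ 𝓝 c := eventually_nhdsWithin_iff.1 hd
  have hb' : IsBoundedUnder (· ≤ ·) (𝓝[≠] c) fun z => ‖f z - f c‖ := by
    obtain ⟨C, hC⟩ := hb
    exact ⟨C + ‖f c‖, eventually_map.2 <| (eventually_map.1 hC).mono fun z hz =>
      norm_sub_le_of_le hz le_rfl⟩
  have hupdate := (Complex.differentiableOn_update_limUnder_of_isLittleO hs
    (fun z hz => (hz.1 hz.2).differentiableWithinAt) hb'.isLittleO_sub_self_inv).differentiableAt hs
  refine hupdate.congr_of_eventuallyEq ?_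
  filter_upwards [hs] with z hz
  rcases eq_or_ne z c with rfl | hzc
  · rw [Function.update_self]
  · rw [Function.update_of_ne hzc]
    exact ((hz hzc).continuousAt.tendsto.mono_left nhdsWithin_le_nhds).limUnder_eq

theorem exists_differentiableOn_eq_smul_of_norm_le [CompleteSpace E] {U : Set ℂ}
    (hU : IsOpen U) (hUc : IsPreconnected U) {g : ℂ → ℂ} {k : ℂ → E}
    (hg : DifferentiableOn ℂ g U) (hk : DifferentiableOn ℂ k U) (hg0 : ∃ z ∈ U, g z ≠ 0)
    {M : ℝ} (hkg : ∀ z ∈ U, ‖k z‖ ≤ M * ‖g z‖) :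
    ∃ q : ℂ → E, DifferentiableOn ℂ q U ∧ (∀ z ∈ U, ‖q z‖ ≤ M) ∧ ∀ z ∈ U, k z = g z • q z := by
  have hd {z : ℂ} (hz : z ∈ U) (hgz : g z ≠ 0) : DifferentiableAt ℂ (fun z => (g z)⁻¹ • k z) z :=
    ((hg.differentiableAt (hU.mem_nhds hz)).inv hgz).smul (hk.differentiableAt (hU.mem_nhds hz))
  have hbound {z : ℂ} (hz : z ∈ U) (hgz : g z ≠ 0) : ‖(g z)⁻¹ • k z‖ ≤ M := by
    rw [norm_smul, norm_inv, inv_mul_le_iff₀ (norm_pos_iff.2 hgz), mul_comm]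
    exact hkg z hz
  have hne {c : ℂ} (hc : c ∈ U) : ∀ᶠ z in 𝓝[≠] c, z ∈ U ∧ g z ≠ 0 := by
    have hcodiscrete :=
      ((hg.analyticOnNhd hU).eqOn_zero_or_eventually_ne_zero_of_preconnected hUc).resolve_left
        fun hzero => hg0.elim fun z hz => hz.2 (hzero hz.1)
    filter_upwards [mem_codiscreteWithin_iff_forall_mem_nhdsNE.1 hcodiscrete c hc,
      mem_nhdsWithin_of_mem_nhds (hU.mem_nhds hc)] with z hgz hz
    exact ⟨hz, hgz.resolve_right (not_not_intro hz)⟩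
  set q : ℂ → E := fun c => limUnder (𝓝[≠] c) fun z => (g z)⁻¹ • k z
  have hqd : DifferentiableOn ℂ q U := fun c hc =>
    (differentiableAt_limUnder_nhdsNE ((hne hc).mono fun z hz => hd hz.1 hz.2)
      ⟨M, eventually_map.2 ((hne hc).mono fun z hz => hbound hz.1 hz.2)⟩).differentiableWithinAt
  have hq {z : ℂ} (hz : z ∈ U) (hgz : g z ≠ 0) : q z = (g z)⁻¹ • k z :=
    ((hd hz hgz).continuousAt.tendsto.mono_left nhdsWithin_le_nhds).limUnder_eq
  refine ⟨q, hqd, fun c hc => ?_, fun z hz => ?_⟩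
  · have hqc : Tendsto q (𝓝[≠] c) (𝓝 (q c)) :=
      (hqd.differentiableAt (hU.mem_nhds hc)).continuousAt.tendsto.mono_left nhdsWithin_le_nhds
    refine le_of_tendsto hqc.norm ((hne hc).mono fun z hz => ?_)
    rw [hq hz.1 hz.2]
    exact hbound hz.1 hz.2
  · rcases eq_or_ne (g z) 0 with hgz | hgz
    · simpa [hgz] using hkg z hz
    · rw [hq hz hgz, smul_inv_smul₀ hgz]

theorem le_of_forall_pow_succ_le_mul_pow {a b C : ℝ} (ha : 0 ≤ a) (hb : 0 ≤ b)
    (h : ∀ n : ℕ, a ^ (n + 1) ≤ C * b ^ n) : a ≤ b := by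
  by_contra! hba
  have hapos : 0 < a := hb.trans_lt hba
  have hlim : Tendsto (fun n : ℕ => C * (b / a) ^ n) atTop (𝓝 (C * 0)) :=
    (tendsto_pow_atTop_nhds_zero_of_lt_one (div_nonneg hb ha)
      ((div_lt_one hapos).2 hba)).const_mul C
  refine hapos.not_ge (mul_zero C ▸ ge_of_tendsto' hlim fun n => ?_)
  rw [div_pow, mul_div_assoc', le_div_iff₀ (pow_pos hapos n), ← pow_succ']
  exact h n

end ComplexAnalysis

namespace WeightedHolo

open Set Filter Topology

variable {U V : Opens ℂ} {v : Weight U} {w : Weight V}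

theorem vanishesAtBoundary_iff_tendsto {g : U → ℝ} :
    VanishesAtBoundary g ↔ Tendsto g (cocompact U) (𝓝 0) := by
  simp only [Metric.tendsto_nhds, Real.dist_0_eq_abs]
  refine forall₂_congr fun ε _ => ⟨?_, fun h => ?_⟩
  · rintro ⟨K, hK, hKU, hg⟩
    have hK' : IsCompact ((↑) ⁻¹' K : Set U) :=
      (IsInducing.subtypeVal.isCompact_preimage_iff (by simpa using hKU)).2 hK
    exact mem_of_superset hK'.compl_mem_cocompact hg
  · obtain ⟨K, hK, hg⟩ := mem_cocompact.1 h
    refine ⟨(↑) '' K, hK.image continuous_subtype_val, ?_,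
      fun z hz => hg fun hzK => hz ⟨z, hzK, rfl⟩⟩
    rintro _ ⟨z, -, rfl⟩
    exact z.2

theorem IsHolomorphic.continuous {f : U → ℂ} (hf : IsHolomorphic f) : Continuous f := by
  obtain ⟨F, hF, hFf⟩ := hf
  exact (continuousOn_iff_continuous_domRestrict.1 hF.continuousOn).congr hFf

theorem IsHolomorphic.mul {f g : U → ℂ} (hf : IsHolomorphic f) (hg : IsHolomorphic g) :
    IsHolomorphic (f * g) := by
  obtain ⟨F, hF, hFf⟩ := hf
  obtain ⟨G, hG, hGg⟩ := hg
  exact ⟨F * G, hF.mul hG, fun z => congrArg₂ (· * ·) (hFf z) (hGg z)⟩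

theorem IsHolomorphic.pow {f : U → ℂ} (hf : IsHolomorphic f) (n : ℕ) : IsHolomorphic (f ^ n) := by
  obtain ⟨F, hF, hFf⟩ := hf
  exact ⟨F ^ n, hF.pow n, fun z => congrArg (· ^ n) (hFf z)⟩

theorem IsHolomorphic.comp {f : U → ℂ} (hf : IsHolomorphic f) {φ : V → U}
    (hφ : IsHolomorphic fun z => (φ z : ℂ)) : IsHolomorphic (f ∘ φ) := by
  obtain ⟨F, hF, hFf⟩ := hf
  obtain ⟨Φ, hΦ, hΦφ⟩ := hφ
  have hmaps : MapsTo Φ V U := fun z hz => by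
    rw [show Φ z = φ ⟨z, hz⟩ from hΦφ ⟨z, hz⟩]
    exact (φ ⟨z, hz⟩).2
  exact ⟨F ∘ Φ, hF.comp hΦ hmaps, fun z => by
    simp only [Function.comp_apply, hΦφ, hFf]⟩

theorem IsHolomorphic.eq_of_not_countable (hU : IsPreconnected (U : Set ℂ)) {f g : U → ℂ}
    (hf : IsHolomorphic f) (hg : IsHolomorphic g) (hfg : ¬ {z | f z = g z}.Countable) : f = g := by
  obtain ⟨F, hF, hFf⟩ := hf
  obtain ⟨G, hG, hGg⟩ := hg
  have hFG : ¬ ({z | F z = G z} ∩ U).Countable := by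
    refine fun hcountable => hfg ((hcountable.preimage Subtype.val_injective).mono fun z hz => ?_)
    exact ⟨(hFf z).trans (hz.trans (hGg z).symm), z.2⟩
  have hEqOn := eqOn_of_not_countable_setOf_eq (hF.analyticOnNhd U.isOpen)
    (hG.analyticOnNhd U.isOpen) hU hFG
  exact funext fun z => (hFf z).symm.trans ((hEqOn z.2).trans (hGg z))

theorem IsHolomorphic.exists_eq_mul_of_norm_le (hU : IsPreconnected (U : Set ℂ)) {g k : U → ℂ}
    (hg : IsHolomorphic g) (hk : IsHolomorphic k) (hg0 : ∃ z, g z ≠ 0)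
    (hkg : ∀ z, ‖k z‖ ≤ ‖g z‖) :
    ∃ q : U → ℂ, IsHolomorphic q ∧ (∀ z, ‖q z‖ ≤ 1) ∧ ∀ z, k z = g z * q z := by
  obtain ⟨G, hG, hGg⟩ := hg
  obtain ⟨K, hK, hKk⟩ := hk
  obtain ⟨a, ha⟩ := hg0
  obtain ⟨Q, hQ, hQ1, hKGQ⟩ := exists_differentiableOn_eq_smul_of_norm_le (M := 1) U.isOpen hU hG hK
    ⟨a, a.2, (hGg a).symm ▸ ha⟩ fun z hz => by
      rw [hGg ⟨z, hz⟩, hKk ⟨z, hz⟩, one_mul]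
      exact hkg _
  refine ⟨fun z => Q z, ⟨Q, hQ, fun _ => rfl⟩, fun z => hQ1 z z.2, fun z => ?_⟩
  rw [← hKk, ← hGg, hKGQ z z.2, smul_eq_mul]

theorem IsHolomorphic.norm_lt (hU : IsPreconnected (U : Set ℂ)) {f : U → ℂ}
    (hf : IsHolomorphic f) {M : ℝ} (hle : ∀ z, ‖f z‖ ≤ M) {a : U} (ha : ‖f a‖ < M) (z : U) :
    ‖f z‖ < M := by
  obtain ⟨F, hF, hFf⟩ := hf
  simp only [← hFf] at hle ha ⊢
  exact norm_lt_of_forall_norm_le_of_norm_lt U.isOpen hU hF (fun z hz => hle ⟨z, hz⟩) a.2 ha z.2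

/-- The function on `U` that an element of `H_{v_o}(U)` is. -/
instance : CoeFun (Hvo v) (fun _ => U → ℂ) := ⟨fun f => (f : Hv v)⟩

theorem evalAt_apply (f : Hvo v) (z : U) : evalAt v z f = f z := rfl

/-- The map `z ↦ v(z)δ_z` from `U` to the dual of `H_{v_o}(U)`, extended by `0` to the point at
infinity; in the weak-* topology this makes it continuous on a compact space. -/
noncomputable def weightedEval (v : Weight U) (p : OnePoint U) : WeakDual ℂ (Hvo v) :=
  p.elim 0 fun z => StrongDual.toWeakDual (((v z : ℝ) : ℂ) • evalAt v z)

theorem weightedEval_infty (f : Hvo v) : weightedEval v OnePoint.infty f = 0 := rfl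

theorem weightedEval_coe (f : Hvo v) (z : U) : weightedEval v z f = (v z : ℂ) * f z := rfl

theorem norm_weightedEval_coe (f : Hvo v) (z : U) : ‖weightedEval v z f‖ = v z * ‖f z‖ := by
  rw [weightedEval_coe, norm_mul, Complex.norm_of_nonneg (v.pos' z).le]

theorem continuous_weightedEval (v : Weight U) : Continuous (weightedEval v) := by
  refine WeakDual.continuous_of_continuous_eval fun f => (OnePoint.continuous_iff _).2 ⟨?_, ?_⟩
  · rw [coclosedCompact_eq_cocompact, weightedEval_infty, tendsto_zero_iff_norm_tendsto_zero]
    simpa only [norm_weightedEval_coe] using vanishesAtBoundary_iff_tendsto.1 f.2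
  · simp only [weightedEval_coe]
    exact (Complex.continuous_ofReal.comp v.continuous').mul (f : Hv v).isHolomorphic.continuous

theorem isLUB_norm_weightedEval (f : Hvo v) : IsLUB (range fun p => ‖weightedEval v p f‖) ‖f‖ := by
  constructor
  · rintro _ ⟨p, rfl⟩
    induction p using OnePoint.rec with
    | infty => simp only [weightedEval_infty, norm_zero, norm_nonneg]
    | coe z => exact (norm_weightedEval_coe f z).trans_le ((f : Hv v).le_norm z)
  · intro C hC
    have hC0 : 0 ≤ C := (norm_nonneg _).trans (hC ⟨OnePoint.infty, rfl⟩)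
    exact Hv.norm_le hC0 fun z => (norm_weightedEval_coe f z).symm.trans_le (hC ⟨z, rfl⟩)

/-- The adjoint of `T` maps the evaluation `δ_ζ` to a nonzero multiple of the evaluation `δ_z`. For
the weighted composition operator `f ↦ h * (f ∘ φ)` this holds with `z = φ ζ` where `h ζ ≠ 0`. -/
def PullsBackEval (T : Hvo v →L[ℂ] Hvo w) (ζ : V) (z : U) : Prop :=
  ∃ c : ℂ, c ≠ 0 ∧ evalAt w ζ ∘L T = c • evalAt v z

theorem exists_pullsBackEval (T : Hvo v →ₗᵢ[ℂ] Hvo w) {z : U} (hz : z ∈ vBoundary v)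
    (hδz : evalAt v z ≠ 0) : ∃ ζ, PullsBackEval T.toContinuousLinearMap ζ z := by
  have hvz : (v z : ℂ) ≠ 0 := Complex.ofReal_ne_zero.2 (v.pos' z).ne'
  let e : OnePoint V → WeakDual ℂ (Hvo v) := fun p =>
    StrongDual.toWeakDual ((weightedEval w p).toStrongDual ∘L T.toContinuousLinearMap)
  have he : Continuous e := WeakDual.continuous_of_continuous_eval fun f =>
    (WeakDual.eval_continuous (T f)).comp (continuous_weightedEval w)
  obtain ⟨c, hc, p, hp⟩ := exists_smul_eq_toWeakDual_of_mem_extremePoints he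
    (fun f => T.norm_map f ▸ isLUB_norm_weightedEval (T f)) hz
  have hp (f : Hvo v) : c * weightedEval w p (T f) = v z * f z := DFunLike.congr_fun hp f
  induction p using OnePoint.rec with
  | infty =>
    refine absurd (ContinuousLinearMap.ext fun f => ?_) hδz
    simpa [weightedEval_infty, evalAt_apply, hvz] using (hp f).symm
  | coe ζ =>
    have hc0 : c ≠ 0 := norm_ne_zero_iff.1 (hc ▸ one_ne_zero)
    have hwζ : (w ζ : ℂ) ≠ 0 := Complex.ofReal_ne_zero.2 (w.pos' ζ).ne'
    refine ⟨ζ, v z / (c * w ζ), div_ne_zero hvz (mul_ne_zero hc0 hwζ),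
      ContinuousLinearMap.ext fun f => ?_⟩
    have hf : c * (w ζ * T f ζ) = v z * f z := hp f
    change T f ζ = v z / (c * w ζ) * f z
    rw [div_mul_eq_mul_div, ← hf, ← mul_assoc, mul_div_cancel_left₀ _ (mul_ne_zero hc0 hwζ)]

theorem VanishesAtBoundary.mul_of_norm_le {g : U → ℝ} (hg : VanishesAtBoundary g) {k : U → ℝ}
    {C : ℝ} (hk : ∀ z, ‖k z‖ ≤ C) : VanishesAtBoundary fun z => g z * k z := by
  rw [vanishesAtBoundary_iff_tendsto] at hg ⊢
  exact hg.zero_mul_isBoundedUnder_le ⟨C, eventually_map.2 (.of_forall hk)⟩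

/-- A bounded holomorphic function as an element of `H_{v_o}(U)`, for a weight that converges to
`0` on the boundary of `U`. -/
noncomputable def ofNormLe (hv : VanishesAtBoundary v.toFun) {f : U → ℂ} (hf : IsHolomorphic f)
    {C : ℝ} (hfC : ∀ z, ‖f z‖ ≤ C) : Hvo v :=
  ⟨⟨f, hf, by
    obtain ⟨M, hM⟩ := v.bdd'
    refine ⟨M * C, ?_⟩
    rintro _ ⟨z, rfl⟩
    exact mul_le_mul (hM ⟨z, rfl⟩) (hfC z) (norm_nonneg _) ((v.pos' z).le.trans (hM ⟨z, rfl⟩))⟩,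
  hv.mul_of_norm_le fun z => (norm_norm (f z)).trans_le (hfC z)⟩

section Disc

variable {v : Weight disc} {T : Hvo v →L[ℂ] Hvo w}

instance uncountable_disc : Uncountable disc :=
  Cardinal.aleph0_lt_mk_iff.1 <| Cardinal.aleph0_lt_continuum.trans_le <|
    continuum_le_cardinal_of_isOpen ℂ disc.isOpen ⟨0, Metric.mem_ball_self one_pos⟩

theorem norm_coe_disc_lt_one (z : disc) : ‖(z : ℂ)‖ < 1 := mem_ball_zero_iff.1 z.2

theorem norm_coe_disc_pow_le_one (n : ℕ) (z : disc) : ‖(z : ℂ) ^ n‖ ≤ 1 := by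
  rw [norm_pow]
  exact pow_le_one₀ (norm_nonneg _) (norm_coe_disc_lt_one z).le

/-- The function `z ↦ z ^ n` as an element of `H_{v_o}(Δ)`. -/
noncomputable def monomial (hv : VanishesAtBoundary v.toFun) (n : ℕ) : Hvo v :=
  ofNormLe hv (f := fun z => (z : ℂ) ^ n) ⟨_, differentiableOn_pow n, fun _ => rfl⟩
    (norm_coe_disc_pow_le_one n)

variable (hv : VanishesAtBoundary v.toFun)

theorem monomial_apply (n : ℕ) (z : disc) : monomial hv n z = (z : ℂ) ^ n := rfl

theorem norm_monomial_le (n : ℕ) : ‖monomial hv n‖ ≤ ‖monomial hv 0‖ := by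
  refine Hv.norm_le (norm_nonneg _) fun z => ?_
  calc v z * ‖monomial hv n z‖ ≤ v z * 1 :=
        mul_le_mul_of_nonneg_left (norm_coe_disc_pow_le_one n z) (v.pos' z).le
    _ = v z * ‖monomial hv 0 z‖ := by rw [monomial_apply, pow_zero, norm_one]
    _ ≤ ‖monomial hv 0‖ := (monomial hv 0 : Hv v).le_norm z

include hv in
theorem evalAt_ne_zero (z : disc) : evalAt v z ≠ 0 := fun h => by
  simpa [evalAt_apply, monomial_apply] using DFunLike.congr_fun h (monomial hv 0)

theorem PullsBackEval.map_monomial_zero_ne_zero {ζ : V} {z : disc} (h : PullsBackEval T ζ z) :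
    T (monomial hv 0) ζ ≠ 0 := by
  obtain ⟨c, hc, hcT⟩ := h
  have h0 : T (monomial hv 0) ζ = c * monomial hv 0 z := DFunLike.congr_fun hcT (monomial hv 0)
  simpa only [h0, monomial_apply, pow_zero, mul_one] using hc

theorem PullsBackEval.map_apply {ζ : V} {z : disc} (h : PullsBackEval T ζ z) (f : Hvo v) :
    T f ζ = T (monomial hv 0) ζ * f z := by
  obtain ⟨c, -, hcT⟩ := h
  have hT (g : Hvo v) : T g ζ = c * g z := DFunLike.congr_fun hcT g
  rw [hT, hT, monomial_apply, pow_zero, mul_one]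

theorem PullsBackEval.map_monomial_one_apply {ζ : V} {z : disc} (h : PullsBackEval T ζ z) :
    T (monomial hv 1) ζ = T (monomial hv 0) ζ * z := by
  rw [h.map_apply hv, monomial_apply, pow_one]

theorem PullsBackEval.eq_of_map_monomial_one_eq {ζ : V} {z z' : disc} (h : PullsBackEval T ζ z)
    (hz' : T (monomial hv 1) ζ = T (monomial hv 0) ζ * z') : z' = z :=
  Subtype.val_injective <| mul_left_cancel₀ (h.map_monomial_zero_ne_zero hv)
    (hz'.symm.trans (h.map_monomial_one_apply hv))

include hv in
theorem not_countable_setOf_pullsBackEval {T : Hvo v →ₗᵢ[ℂ] Hvo w}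
    (hvB : ¬ (vBoundary v).Countable) :
    ¬ {ζ | ∃ z, PullsBackEval T.toContinuousLinearMap ζ z}.Countable := by
  intro hcountable
  refine hvB (((hcountable.image fun ζ =>
    T (monomial hv 1) ζ / T (monomial hv 0) ζ).preimage Subtype.val_injective).mono fun z hz => ?_)
  obtain ⟨ζ, hζ⟩ := exists_pullsBackEval T hz (evalAt_ne_zero hv z)
  exact ⟨ζ, ⟨z, hζ⟩, (div_eq_iff (hζ.map_monomial_zero_ne_zero hv)).2
    ((hζ.map_monomial_one_apply hv).trans (mul_comm _ _))⟩

variable (hV : IsPreconnected (V : Set ℂ)) (hT : ¬ {ζ | ∃ z, PullsBackEval T ζ z}.Countable)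
include hV hT

theorem map_monomial_one_pow_succ (n : ℕ) (ζ : V) :
    T (monomial hv 1) ζ ^ (n + 1) = T (monomial hv 0) ζ ^ n * T (monomial hv (n + 1)) ζ := by
  have hhol (f : Hvo v) : IsHolomorphic (T f) := (T f : Hv w).isHolomorphic
  refine congrFun (((hhol _).pow (n + 1)).eq_of_not_countable hV (((hhol _).pow n).mul (hhol _))
    fun h => hT (h.mono ?_)) ζ
  rintro ξ ⟨z, hz⟩
  change T (monomial hv 1) ξ ^ (n + 1) = T (monomial hv 0) ξ ^ n * T (monomial hv (n + 1)) ξ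
  rw [hz.map_monomial_one_apply hv, hz.map_apply hv (monomial hv (n + 1)), monomial_apply]
  ring

theorem norm_map_monomial_one_le (ζ : V) :
    ‖T (monomial hv 1) ζ‖ ≤ ‖T (monomial hv 0) ζ‖ := by
  refine le_of_forall_pow_succ_le_mul_pow (C := ‖T‖ * ‖monomial hv 0‖ / w ζ) (norm_nonneg _)
    (norm_nonneg _) fun n => ?_
  have hbound : ‖T (monomial hv (n + 1)) ζ‖ ≤ ‖T‖ * ‖monomial hv 0‖ / w ζ := by
    rw [le_div_iff₀' (w.pos' ζ)]
    exact ((T (monomial hv (n + 1)) : Hv w).le_norm ζ).trans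
      (T.le_opNorm_of_le (norm_monomial_le hv (n + 1)))
  rw [← norm_pow, map_monomial_one_pow_succ hv hV hT, norm_mul, norm_pow, mul_comm]
  exact mul_le_mul_of_nonneg_right hbound (by positivity)

theorem exists_isHolomorphic_map_monomial_one_eq_mul :
    ∃ φ : V → disc, IsHolomorphic (fun ζ => (φ ζ : ℂ)) ∧
      ∀ ζ, T (monomial hv 1) ζ = T (monomial hv 0) ζ * φ ζ := by
  obtain ⟨a, z, haz⟩ : {ζ | ∃ z, PullsBackEval T ζ z}.Nonempty :=
    nonempty_iff_ne_empty.2 fun hempty => hT (hempty ▸ countable_empty)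
  have ha := haz.map_monomial_zero_ne_zero hv
  obtain ⟨q, hq, hq1, hTq⟩ := IsHolomorphic.exists_eq_mul_of_norm_le hV
    (T (monomial hv 0) : Hv w).isHolomorphic (T (monomial hv 1) : Hv w).isHolomorphic
    ⟨a, ha⟩ (norm_map_monomial_one_le hv hV hT)
  have hqa : q a = z := mul_left_cancel₀ ha ((hTq a).symm.trans (haz.map_monomial_one_apply hv))
  have hq_lt := hq.norm_lt hV hq1 (hqa ▸ norm_coe_disc_lt_one z)
  exact ⟨fun ζ => ⟨q ζ, mem_ball_zero_iff.2 (hq_lt ζ)⟩, hq, hTq⟩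

theorem exists_isHolomorphic_map_eq_mul_comp :
    ∃ φ : V → disc, IsHolomorphic (fun ζ => (φ ζ : ℂ)) ∧
      ∀ (f : Hvo v) (ζ : V), T f ζ = T (monomial hv 0) ζ * f (φ ζ) := by
  obtain ⟨φ, hφ, hTφ⟩ := exists_isHolomorphic_map_monomial_one_eq_mul hv hV hT
  refine ⟨φ, hφ, fun f => congrFun <| (T f : Hv w).isHolomorphic.eq_of_not_countable hV
    ((T (monomial hv 0) : Hv w).isHolomorphic.mul ((f : Hv v).isHolomorphic.comp hφ))
    fun h => hT (h.mono ?_)⟩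
  rintro ζ ⟨z, hz⟩
  obtain rfl : φ ζ = z := hz.eq_of_map_monomial_one_eq hv (hTφ ζ)
  exact hz.map_apply hv f

end Disc

end WeightedHolo

theorem theorem2p3_general (V : TopologicalSpace.Opens ℂ) (hV : IsPreconnected (V : Set ℂ))
    (v : WeightedHolo.Weight WeightedHolo.disc) (w : WeightedHolo.Weight V)
    (hv : ¬ (WeightedHolo.vBoundary v).Countable) (hv0 : WeightedHolo.VanishesAtBoundary v.toFun)
    (T : WeightedHolo.Hvo v →ₗᵢ[ℂ] WeightedHolo.Hvo w) :
    ∃ φ : V → WeightedHolo.disc,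
      WeightedHolo.IsHolomorphic (fun z : V => (φ z : ℂ)) ∧
        WeightedHolo.vBoundary v ⊆ Set.range φ ∧
        ∃ h : WeightedHolo.Hvo w, ∀ (f : WeightedHolo.Hvo v) (z : V),
          (T f : WeightedHolo.Hv w) z =
            (h : WeightedHolo.Hv w) z * (f : WeightedHolo.Hv v) (φ z) := by
  obtain ⟨φ, hφ, hTφ⟩ := WeightedHolo.exists_isHolomorphic_map_eq_mul_comp hv0 hV
    (WeightedHolo.not_countable_setOf_pullsBackEval hv0 hv (T := T))
  refine ⟨φ, hφ, fun z hz => ?_, T (WeightedHolo.monomial hv0 0), hTφ⟩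
  obtain ⟨ζ, hζ⟩ :=
    WeightedHolo.exists_pullsBackEval T hz (WeightedHolo.evalAt_ne_zero hv0 z)
  refine ⟨ζ, hζ.eq_of_map_monomial_one_eq hv0 ?_⟩
  rw [hTφ, WeightedHolo.monomial_apply, pow_one]

theorem theorem2p3 (V : TopologicalSpace.Opens ℂ) (hV : IsPreconnected (V : Set ℂ))
    (v : WeightedHolo.Weight WeightedHolo.disc) (w : WeightedHolo.Weight V)
    (hv : v.IsComplete) (hv0 : WeightedHolo.VanishesAtBoundary v.toFun)
    (T : WeightedHolo.Hvo v →ₗᵢ[ℂ] WeightedHolo.Hvo w) :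
    ∃ φ : V → WeightedHolo.disc,
      WeightedHolo.IsHolomorphic (fun z : V => (φ z : ℂ)) ∧ Function.Surjective φ ∧
        ∃ h : WeightedHolo.Hvo w, ∀ (f : WeightedHolo.Hvo v) (z : V),
          (T f : WeightedHolo.Hv w) z =
            (h : WeightedHolo.Hv w) z * (f : WeightedHolo.Hv v) (φ z) := by
  have huncountable : ¬ (WeightedHolo.vBoundary v).Countable :=
    hv ▸ Set.not_countable_univ
  obtain ⟨φ, hφ, hrange, hT⟩ := theorem2p3_general V hV v w huncountable hv0 T
  exact ⟨φ, hφ, fun z => hrange (hv ▸ Set.mem_univ z), hT⟩
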